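/- Let $M$ be a connected closed surface (a compact connected 2-dimensional topological manifold without boundary) with a triangulation $\mathcal T=(V,E,F)$, that is, a homeomorphism of $M$ with the geometric realization of a finite simplicial complex with vertex set $V$, edge set $E$ and set of triangular faces $F$. Let $\Phi:E\to[0,\frac{\pi}{2}]$ be a weight on the edges. A circle packing metric is a map $r:V\to(0,+\infty)$. It gives each edge $\{ij\}$ the length $$l_{ij}=\sqrt{r_i^2+r_j^2+2r_ir_j\cos\Phi_{ij}},$$ and for each face $\{ijk\}\in F$ it determines a Euclidean triangle with side lengths $l_{ij},l_{jk},l_{ik}$, whose inner angle at the vertex $i$ is denoted by $\theta_i^{jk}$. Put $$K_i=2\pi-\sum_{\{ijk\}\in F}\theta_i^{jk},\qquad R_i=\frac{K_i}{r_i^2}\qquad(i\in V),$$ where the sum is over all faces that have $i$ as a vertex. Theorem. Let $c^*\in\mathbb R$ be a constant. (1) If $c^*<0$, there exists at most one circle packing metric $r$ with $R_i=c^*$ for all $i\in V$. (2) If $c^*=0$, there exists at most one circle packing metric $r$ with $R_i=c^*$ for all $i\in V$ up to scaling: if $r$ and $r'$ are two such metrics, then there is a constant $t>0$ with $r'_i=t\,r_i$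 for all $i\in V$. -/

import Mathlib

noncomputable section

namespace CirclePacking

/-- The geometric realization of a simplicial complex on a finite vertex set, in barycentric
coordinates: the points of the standard simplex whose support is a face. -/
def realization {V : Type*} [Fintype V] (K : AbstractSimplicialComplex V) : Set (V → ℝ) :=
  {x | x ∈ stdSimplex ℝ V ∧ ∃ s ∈ K, ∀ v, x v ≠ 0 ↔ v ∈ s}

/-- A weighted triangulation `(M, 𝒯, Φ)` of a space `M` with vertex set `V`:
a simplicial complex consisting of vertices, edges and (triangular) faces, a homeomorphism of its
geometric realization with `M`, and a weight in `[0, π/2]` on every edge. The weight is a function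
on unordered pairs of vertices; only its values on edges are used. -/
structure WeightedTriangulation (M : Type*) [TopologicalSpace M]
    (V : Type*) [Fintype V] [DecidableEq V] where
  complex : AbstractSimplicialComplex V
  card_le_three : ∀ s ∈ complex, s.card ≤ 3
  homeo : realization complex ≃ₜ M
  weight : Sym2 V → ℝ
  weight_mem : ∀ i j : V, i ≠ j → ({i, j} : Finset V) ∈ complex →
    weight s(i, j) ∈ Set.Icc 0 (Real.pi / 2)

/-- A circle packing metric: a positive function on the vertices. -/
def IsCirclePackingMetric {V : Type*} (r : V → ℝ) : Prop := ∀ i, 0 < r i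

namespace WeightedTriangulation

variable {M : Type*} [TopologicalSpace M] {V : Type*} [Fintype V] [DecidableEq V]

/-- `i, j, k` are the three (distinct) vertices of a face of the triangulation. -/
def IsTriangle (T : WeightedTriangulation M V) (i j k : V) : Prop :=
  i ≠ j ∧ i ≠ k ∧ j ≠ k ∧ ({i, j, k} : Finset V) ∈ T.complex

/-- The length of the edge `{i, j}`. -/
def edgeLength (T : WeightedTriangulation M V) (r : V → ℝ) (i j : V) : ℝ :=
  Real.sqrt (r i ^ 2 + r j ^ 2 + 2 * r i * r j * Real.cos (T.weight s(i, j)))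

/-- The inner angle at `i` of the Euclidean triangle with vertices `i, j, k` and side lengths
`edgeLength`, by the law of cosines. -/
def innerAngle (T : WeightedTriangulation M V) (r : V → ℝ) (i j k : V) : ℝ :=
  Real.arccos ((T.edgeLength r i j ^ 2 + T.edgeLength r i k ^ 2 - T.edgeLength r j k ^ 2) /
    (2 * T.edgeLength r i j * T.edgeLength r i k))

open Classical in
/-- The classical discrete Gauss curvature `K_i`, the angle deficit at `i`. The factor `1 / 2`
compensates that each triangle at `i` occurs twice, as `(j, k)` and as `(k, j)`. -/
def classicalCurvature (T : WeightedTriangulation M V) (r : V → ℝ) (i : V) : ℝ :=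
  2 * Real.pi - (1 / 2) * ∑ j, ∑ k, if T.IsTriangle i j k then T.innerAngle r i j k else 0

/-- The discrete Gauss curvature `R_i = K_i / r_i ^ 2`. -/
def curvature (T : WeightedTriangulation M V) (r : V → ℝ) (i : V) : ℝ :=
  T.classicalCurvature r i / r i ^ 2

end WeightedTriangulation

end CirclePacking

end

/-! The proof is a discrete maximum principle. Weights in [0, π/2] have cosines in [0, 1], so with
`r i` fixed every angle at `i` is nondecreasing in the radii of its neighbours
(`cosAngle_le_cosAngle`). Hence if `s ≤ t • r` with equality at `i`, then the angle deficits satisfy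
K_i(s) ≥ K_i(t • r) = K_i(r), by scale invariance. Such a `t` always exists: the largest ratio s_v /
r_v.

For c < 0 this reads c s_i² ≥ c r_i², so s_i ≤ r_i; as s_i = t r_i, t ≤ 1 and `s ≤ r`. Exchanging
the metrics gives equality.

For c = 0 the deficits agree everywhere. Equality at `i` then forces equality of all angles at `i`,
and strict monotonicity spreads contact to the neighbours. Every edge of a surface lies in a
triangle and the complex is connected, so contact holds at all vertices. -/

open Set Topology

/-! ### Monotonicity of the angle in the radii -/

section Angle

/-- The cosine of the angle between the sides with radii `x, y` and `x, z` in the triangle of three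
circles with radii `x, y, z` that meet at angles with cosines `a` (for `x, y`), `b` (for `x, z`)
and `d` (for `y, z`). -/
noncomputable def cosAngle (a b d x y z : ℝ) : ℝ :=
  (x ^ 2 + a * x * y + b * x * z - d * y * z) /
    (√(x ^ 2 + y ^ 2 + 2 * x * y * a) * √(x ^ 2 + z ^ 2 + 2 * x * z * b))

theorem cosAngle_swap (a b d x y z : ℝ) : cosAngle a b d x y z = cosAngle b a d x z y := by
  unfold cosAngle
  congr 1 <;> ring

/-- The product of the squared lengths minus the squared numerator is a sum of nonnegative terms.
Thus the value lies where `arccos` is injective, and equal angles give equal cosines. -/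
theorem abs_cosAngle_le_one {a b d x y z : ℝ} (ha : a ∈ Icc (0 : ℝ) 1) (hb : b ∈ Icc (0 : ℝ) 1)
    (hd : d ∈ Icc (0 : ℝ) 1) (hx : 0 < x) (hy : 0 < y) (hz : 0 < z) :
    |cosAngle a b d x y z| ≤ 1 := by
  obtain ⟨ha0, ha1⟩ := ha
  obtain ⟨hb0, hb1⟩ := hb
  obtain ⟨hd0, hd1⟩ := hd
  have hP : 0 < x ^ 2 + y ^ 2 + 2 * x * y * a := by positivity
  have hQ : 0 < x ^ 2 + z ^ 2 + 2 * x * z * b := by positivity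
  have ha2 : 0 ≤ 1 - a ^ 2 := by nlinarith
  have hb2 : 0 ≤ 1 - b ^ 2 := by nlinarith
  have hd2 : 0 ≤ 1 - d ^ 2 := by nlinarith
  unfold cosAngle
  rw [← Real.sqrt_mul hP.le, abs_div, abs_of_nonneg (Real.sqrt_nonneg _),
    div_le_one (Real.sqrt_pos.2 (mul_pos hP hQ))]
  apply Real.abs_le_sqrt
  have key : (x ^ 2 + y ^ 2 + 2 * x * y * a) * (x ^ 2 + z ^ 2 + 2 * x * z * b) -
      (x ^ 2 + a * x * y + b * x * z - d * y * z) ^ 2 =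
      x ^ 2 * y ^ 2 * (1 - a ^ 2) + x ^ 2 * z ^ 2 * (1 - b ^ 2) + y ^ 2 * z ^ 2 * (1 - d ^ 2) +
      2 * x * y * z * (x * (d + a * b) + y * (b + a * d) + z * (a + b * d)) := by ring
  have : 0 ≤ x ^ 2 * y ^ 2 * (1 - a ^ 2) + x ^ 2 * z ^ 2 * (1 - b ^ 2) +
      y ^ 2 * z ^ 2 * (1 - d ^ 2) +
      2 * x * y * z * (x * (d + a * b) + y * (b + a * d) + z * (a + b * d)) := by positivity
  linarith

/-- In this form the sign is visible: for cosines in [0, 1] the derivative is nonpositive, and it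
vanishes only if `a = 1` and `b = d = 0`. -/
theorem hasDerivAt_cosAngle {a b d x y z : ℝ} (ha : 0 ≤ a) (hx : 0 < x) (hy : 0 < y) :
    HasDerivAt (fun y => cosAngle a b d x y z)
      (-(y * ((1 - a ^ 2) * x ^ 2 + x * z * (a * d + b)) + x ^ 2 * z * (d + a * b)) /
        (√(x ^ 2 + y ^ 2 + 2 * x * y * a) ^ 3 * √(x ^ 2 + z ^ 2 + 2 * x * z * b))) y := by
  have hP : 0 < x ^ 2 + y ^ 2 + 2 * x * y * a := by positivity
  have hN : HasDerivAt (fun y => x ^ 2 + a * x * y + b * x * z - d * y * z)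
      (a * x - d * z) y := by
    have h := (((((hasDerivAt_id y).const_mul (a * x)).const_add (x ^ 2)).add_const
      (b * x * z)).sub (((hasDerivAt_id y).const_mul d).mul_const z))
    simpa using! h
  have hQ : HasDerivAt (fun y => x ^ 2 + y ^ 2 + 2 * x * y * a) (2 * y + 2 * x * a) y := by
    have h := (((hasDerivAt_id y).pow 2).const_add (x ^ 2)).add
      (((hasDerivAt_id y).const_mul (2 * x)).mul_const a)
    simpa using! h
  have hs := Real.sqrt_pos.2 hP
  have hg := (hN.div (hQ.sqrt hP.ne') hs.ne').div_const √(x ^ 2 + z ^ 2 + 2 * x * z * b)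
  have hfun : (fun y => cosAngle a b d x y z) = fun y =>
      ((fun y => x ^ 2 + a * x * y + b * x * z - d * y * z : ℝ → ℝ) /
        (fun y => √(x ^ 2 + y ^ 2 + 2 * x * y * a) : ℝ → ℝ)) y / √(x ^ 2 + z ^ 2 + 2 * x * z * b) := by
    funext y
    simp only [cosAngle, Pi.div_apply, div_div]
  rw [hfun]
  convert! hg using 1
  rw [← div_div]
  congr 1
  have hsq := Real.sq_sqrt hP.le
  set s := √(x ^ 2 + y ^ 2 + 2 * x * y * a)
  field_simp
  rw [hsq]
  ring

theorem continuousOn_cosAngle {a b d x z : ℝ} (ha : 0 ≤ a) (hx : 0 < x) :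
    ContinuousOn (fun y => cosAngle a b d x y z) (Ioi 0) := fun _ hy =>
  (hasDerivAt_cosAngle ha hx hy).continuousAt.continuousWithinAt

theorem antitoneOn_cosAngle {a b d x z : ℝ} (ha : a ∈ Icc (0 : ℝ) 1) (hb : 0 ≤ b) (hd : 0 ≤ d)
    (hx : 0 < x) (hz : 0 < z) : AntitoneOn (fun y => cosAngle a b d x y z) (Ioi 0) := by
  obtain ⟨ha0, ha1⟩ := ha
  have ha2 : 0 ≤ 1 - a ^ 2 := by nlinarith
  refine antitoneOn_of_deriv_nonpos (convex_Ioi 0) (continuousOn_cosAngle ha0 hx) ?_ ?_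
  · rw [interior_Ioi]
    exact fun y hy => (hasDerivAt_cosAngle ha0 hx hy).differentiableAt.differentiableWithinAt
  · rw [interior_Ioi]
    intro y hy
    have hy : 0 < y := hy
    rw [(hasDerivAt_cosAngle ha0 hx hy).deriv]
    refine div_nonpos_of_nonpos_of_nonneg (neg_nonpos.2 ?_) ?_ <;> positivity

/-- The last hypothesis excludes exactly `a = 1`, `b = d = 0`, where the cosine is x / √(x² + z²),
independent of `y`. -/
theorem strictAntiOn_cosAngle {a b d x z : ℝ} (ha : a ∈ Icc (0 : ℝ) 1) (hb : 0 ≤ b) (hd : 0 ≤ d)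
    (hx : 0 < x) (hz : 0 < z) (h : a < 1 ∨ 0 < b ∨ 0 < d) :
    StrictAntiOn (fun y => cosAngle a b d x y z) (Ioi 0) := by
  obtain ⟨ha0, ha1⟩ := ha
  refine strictAntiOn_of_deriv_neg (convex_Ioi 0) (continuousOn_cosAngle ha0 hx) ?_
  rw [interior_Ioi]
  intro y hy
  have hy : 0 < y := hy
  rw [(hasDerivAt_cosAngle ha0 hx hy).deriv]
  refine div_neg_of_neg_of_pos (neg_neg_iff_pos.2 ?_) (by positivity)
  have ha2 : 0 ≤ 1 - a ^ 2 := by nlinarith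
  rcases h with h | h | h
  · have : 0 < 1 - a ^ 2 := by nlinarith
    positivity
  · positivity
  · positivity

theorem cosAngle_le_cosAngle {a b d x y y' z z' : ℝ} (ha : a ∈ Icc (0 : ℝ) 1)
    (hb : b ∈ Icc (0 : ℝ) 1) (hd : 0 ≤ d) (hx : 0 < x) (hy : 0 < y) (hz : 0 < z)
    (hyy : y ≤ y') (hzz : z ≤ z') : cosAngle a b d x y' z' ≤ cosAngle a b d x y z := by
  have hy' := hy.trans_le hyy
  calc cosAngle a b d x y' z' ≤ cosAngle a b d x y' z := by
        rw [cosAngle_swap a, cosAngle_swap a]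
        exact antitoneOn_cosAngle hb ha.1 hd hx hy' hz (hz.trans_le hzz) hzz
    _ ≤ cosAngle a b d x y z := antitoneOn_cosAngle ha hb.1 hd hx hz hy hy' hyy

theorem eq_of_cosAngle_le_cosAngle {a b d x y y' z z' : ℝ} (ha : a ∈ Icc (0 : ℝ) 1)
    (hb : b ∈ Icc (0 : ℝ) 1) (hd : 0 ≤ d) (hx : 0 < x) (hy : 0 < y) (hz : 0 < z)
    (hyy : y ≤ y') (hzz : z ≤ z') (h : a < 1 ∨ 0 < b ∨ 0 < d)
    (hle : cosAngle a b d x y z ≤ cosAngle a b d x y' z') : y = y' := by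
  by_contra hne
  have hlt : y < y' := lt_of_le_of_ne hyy hne
  have h1 : cosAngle a b d x y' z < cosAngle a b d x y z :=
    strictAntiOn_cosAngle ha hb.1 hd hx hz h hy (hy.trans hlt) hlt
  have h2 := cosAngle_le_cosAngle ha hb hd hx (hy.trans hlt) hz le_rfl hzz
  linarith

end Angle

/-! ### No injective continuous real function in dimension at least two -/

section Topology

/-- A real function that is continuous near a point of a space of dimension at least two is not
injective near that point. -/
theorem not_injOn_of_one_lt_rank {E : Type*} [NormedAddCommGroup E] [NormedSpace ℝ E]
    (hE : 1 < Module.rank ℝ E) {f : E → ℝ} {U : Set E} {p : E} (hU : U ∈ 𝓝 p)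
    (hf : ContinuousOn f U) : ¬ InjOn f U := by
  intro hinj
  obtain ⟨ε, hε, hball⟩ := Metric.nhds_basis_closedBall.mem_iff.1 hU
  have hmem : ∀ x ∈ Metric.sphere (0 : E) ε, p + x ∈ U ∧ p - x ∈ U := by
    intro x hx
    have hx : ‖x‖ = ε := by simpa using hx
    constructor <;> apply hball <;> simp [hx]
  have hcont : ContinuousOn (fun x => f (p + x) - f (p - x)) (Metric.sphere 0 ε) :=
    (hf.comp (by fun_prop) fun x hx => (hmem x hx).1).sub
      (hf.comp (by fun_prop) fun x hx => (hmem x hx).2)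
  obtain ⟨w, hw⟩ := (isConnected_sphere hE 0 hε.le).nonempty
  have hw' : -w ∈ Metric.sphere (0 : E) ε := by simpa using hw
  have hconn := isPreconnected_sphere hE 0 ε
  -- As in one-dimensional Borsuk–Ulam, an odd continuous function on a connected sphere has a zero,
  -- so `f` agrees at two antipodal points.
  have hzero : (0 : ℝ) ∈ (fun x => f (p + x) - f (p - x)) '' Metric.sphere 0 ε := by
    have hneg : f (p + -w) - f (p - -w) = -(f (p + w) - f (p - w)) := by
      rw [← sub_eq_add_neg, sub_neg_eq_add]; ring
    rcases le_total 0 (f (p + w) - f (p - w)) with h | h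
    · exact hconn.intermediate_value hw' hw hcont ⟨by simp only [hneg]; linarith, h⟩
    · exact hconn.intermediate_value hw hw' hcont ⟨h, by simp only [hneg]; linarith⟩
  obtain ⟨x, hx, hx0⟩ := hzero
  have heq := hinj (hmem x hx).1 (hmem x hx).2 (sub_eq_zero.1 hx0)
  have hx1 : x = -x := by simpa [sub_eq_add_neg] using heq
  have hx2 : x = 0 := by
    have : (2 : ℝ) • x = 0 := by rw [two_smul]; exact add_eq_zero_iff_eq_neg.2 hx1
    exact (smul_eq_zero.1 this).resolve_left two_ne_zero
  have : ‖x‖ = ε := by simpa using hx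
  rw [hx2, norm_zero] at this
  exact hε.ne this

end Topology

/-! ### Local and global structure of the triangulated surface -/

namespace CirclePacking.WeightedTriangulation

variable {M : Type*} [TopologicalSpace M] {V : Type*} [Fintype V] [DecidableEq V]

theorem mem_complex_of_subset (T : WeightedTriangulation M V) {s t : Finset V}
    (hs : s ∈ T.complex) (hts : t ⊆ s) (ht : t.Nonempty) : t ∈ T.complex :=
  (T.complex.isRelLowerSet_faces hs).2 hts ht

/-- On a surface every edge is an edge of a triangle. -/
theorem exists_isTriangle [ChartedSpace (EuclideanSpace ℝ (Fin 2)) M]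
    (T : WeightedTriangulation M V) {i j : V} (hij : i ≠ j)
    (hedge : ({i, j} : Finset V) ∈ T.complex) : ∃ k, T.IsTriangle i j k := by
  by_contra! hno
  have hsupp : ∀ s ∈ T.complex, i ∈ s → j ∈ s → s = {i, j} := by
    intro s hs hi hj
    have hsub : ({i, j} : Finset V) ⊆ s := by
      intro v hv
      rcases Finset.mem_insert.1 hv with rfl | hv
      · exact hi
      · rwa [Finset.mem_singleton.1 hv]
    refine (Finset.Subset.antisymm hsub fun k hk => ?_).symm
    by_contra hkn
    simp only [Finset.mem_insert, Finset.mem_singleton, not_or] at hkn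
    refine hno k ⟨hij, Ne.symm hkn.1, Ne.symm hkn.2, T.mem_complex_of_subset hs ?_ (by simp)⟩
    intro v hv
    simp only [Finset.mem_insert, Finset.mem_singleton] at hv
    rcases hv with rfl | rfl | rfl <;> assumption
  -- The midpoint of the edge. Without a triangle on the edge, the neighbourhood `W` below is an
  -- open arc on which one barycentric coordinate is injective; read in a planar chart, this is
  -- impossible.
  let m : V → ℝ := fun v => if v = i ∨ v = j then 1 / 2 else 0
  have hm : m ∈ realization T.complex := by
    refine ⟨⟨fun v => ?_, ?_⟩, {i, j}, hedge, fun v => ?_⟩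
    · simp only [m]; split_ifs <;> norm_num
    · have : Finset.univ.filter (fun v => v = i ∨ v = j) = {i, j} := by ext; simp
      simp only [m]
      rw [← Finset.sum_filter, this, Finset.sum_pair hij]
      norm_num
    · simp [m, or_iff_not_imp_left]
  let p : M := T.homeo ⟨m, hm⟩
  let e := chartAt (EuclideanSpace ℝ (Fin 2)) p
  let W : Set M := {q | 0 < (T.homeo.symm q).1 i ∧ 0 < (T.homeo.symm q).1 j}
  have hcoord : ∀ v, Continuous fun q : M => (T.homeo.symm q).1 v := fun v =>
    (continuous_apply v).comp (continuous_subtype_val.comp T.homeo.symm.continuous)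
  have hW : IsOpen W :=
    (isOpen_lt continuous_const (hcoord i)).inter (isOpen_lt continuous_const (hcoord j))
  have hpW : p ∈ W := by simp [W, p, m]
  have hWinj : InjOn (fun q : M => (T.homeo.symm q).1 i) W := by
    have hform : ∀ q ∈ W, ∀ v, (T.homeo.symm q).1 v =
        if v = i then (T.homeo.symm q).1 i else if v = j then 1 - (T.homeo.symm q).1 i else 0 := by
      intro q hq v
      obtain ⟨⟨-, hsum⟩, s, hs, hsv⟩ := (T.homeo.symm q).2
      obtain rfl := hsupp s hs ((hsv i).1 hq.1.ne') ((hsv j).1 hq.2.ne')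
      have hzero : ∀ v, v ∉ ({i, j} : Finset V) → (T.homeo.symm q).1 v = 0 := fun v hv => by
        by_contra hne
        exact hv ((hsv v).1 hne)
      rw [← Finset.sum_subset (Finset.subset_univ {i, j}) fun v _ hv => hzero v hv,
        Finset.sum_pair hij] at hsum
      split_ifs with h1 h2
      · rw [h1]
      · rw [h2]; linarith
      · exact hzero v (by simp [h1, h2])
    intro q hq q' hq' h
    have h : (T.homeo.symm q).1 i = (T.homeo.symm q').1 i := h
    refine T.homeo.symm.injective (Subtype.ext (funext fun v => ?_))
    rw [hform q hq v, hform q' hq' v, h]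
  have hnhds : e.target ∩ e.symm ⁻¹' W ∈ 𝓝 (e p) := by
    refine Filter.inter_mem (chart_target_mem_nhds _ p) ?_
    refine (e.continuousAt_symm (mem_chart_target _ p)).preimage_mem_nhds ?_
    rw [e.left_inv (mem_chart_source _ p)]
    exact hW.mem_nhds hpW
  refine not_injOn_of_one_lt_rank (by simp [← Module.finrank_eq_rank]) hnhds
    (f := fun u => (T.homeo.symm (e.symm u)).1 i) ?_ ?_
  · exact (hcoord i).comp_continuousOn (e.continuousOn_symm.mono inter_subset_left)
  · exact hWinj.comp (e.symm.injOn.mono inter_subset_left) fun u hu => hu.2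

/-- A nonempty set of vertices of a connected complex that is closed under passing to the other
vertex of an edge contains all vertices. -/
theorem eq_univ_of_edge_closed [ConnectedSpace M] (T : WeightedTriangulation M V) {S : Set V}
    (hne : S.Nonempty)
    (hS : ∀ i ∈ S, ∀ j, i ≠ j → ({i, j} : Finset V) ∈ T.complex → j ∈ S) : S = univ := by
  classical
  by_contra hSu
  obtain ⟨w, hw⟩ := (ne_univ_iff_exists_notMem S).1 hSu
  obtain ⟨v, hv⟩ := hne
  -- The barycentric mass on `S`. The vertices of a face lie all in `S` or all outside, so `g` takes
  -- only the values 0 and 1, and connectedness rules out both occurring.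
  let g : realization T.complex → ℝ := fun x => ∑ u, if u ∈ S then x.1 u else 0
  have hg : Continuous g := by
    refine continuous_finsetSum _ fun u _ => ?_
    split_ifs
    · exact (continuous_apply u).comp continuous_subtype_val
    · exact continuous_const
  have hvals : ∀ x, g x = 0 ∨ g x = 1 := by
    rintro ⟨x, ⟨hx0, hx1⟩, s, hs, hsx⟩
    by_cases h : ∃ u ∈ s, u ∈ S
    · right
      obtain ⟨u, hus, huS⟩ := h
      refine Eq.trans ?_ hx1
      refine Finset.sum_congr rfl fun u' _ => ?_
      split_ifs with hu'
      · rfl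
      · by_contra hne
        have hu's : u' ∈ s := (hsx u').1 (Ne.symm hne)
        refine hu' (hS u huS u' (fun h => hu' (h ▸ huS)) (T.mem_complex_of_subset hs ?_ (by simp)))
        intro a ha
        rcases Finset.mem_insert.1 ha with rfl | ha
        · exact hus
        · rwa [Finset.mem_singleton.1 ha]
    · left
      push Not at h
      refine Finset.sum_eq_zero fun u _ => ?_
      split_ifs with hu
      · by_contra hne
        exact h u ((hsx u).1 hne) hu
      · rfl
  have hmem : ∀ u : V, Pi.single u (1 : ℝ) ∈ realization T.complex := fun u =>
    ⟨single_mem_stdSimplex ℝ u, {u}, T.complex.singleton_mem u, fun a => by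
      simp [Pi.single_apply]⟩
  have hgsingle : ∀ u, g ⟨Pi.single u 1, hmem u⟩ = if u ∈ S then 1 else 0 := by
    intro u
    simp only [g]
    rw [Finset.sum_eq_single u (fun b _ hb => by simp [hb]) (by simp)]
    simp
  have : ConnectedSpace (realization T.complex) := T.homeo.symm.surjective.connectedSpace
    T.homeo.symm.continuous
  obtain ⟨x, hx⟩ : (1 / 2 : ℝ) ∈ range g := by
    refine mem_range_of_exists_le_of_exists_ge hg ⟨⟨Pi.single w 1, hmem w⟩, ?_⟩
      ⟨⟨Pi.single v 1, hmem v⟩, ?_⟩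
    · rw [hgsingle, if_neg hw]; norm_num
    · rw [hgsingle, if_pos hv]; norm_num
  rcases hvals x with h | h <;> rw [hx] at h <;> norm_num at h

/-! ### Angles and curvature in terms of the radii -/

/-- The cosine of the weight of an edge. -/
noncomputable def edgeCos (T : WeightedTriangulation M V) (i j : V) : ℝ := Real.cos (T.weight s(i, j))

theorem edgeCos_comm (T : WeightedTriangulation M V) (i j : V) : T.edgeCos i j = T.edgeCos j i := by
  rw [edgeCos, edgeCos, Sym2.eq_swap]

theorem edgeCos_mem (T : WeightedTriangulation M V) {i j : V} (hij : i ≠ j)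
    (h : ({i, j} : Finset V) ∈ T.complex) : T.edgeCos i j ∈ Icc (0 : ℝ) 1 := by
  obtain ⟨h0, h1⟩ := T.weight_mem i j hij h
  exact ⟨Real.cos_nonneg_of_mem_Icc ⟨by linarith [Real.pi_pos], h1⟩, Real.cos_le_one _⟩

namespace IsTriangle

variable {T : WeightedTriangulation M V} {i j k : V}

theorem swap_right (h : T.IsTriangle i j k) : T.IsTriangle i k j :=
  ⟨h.2.1, h.1, h.2.2.1.symm, by rw [Finset.pair_comm k j]; exact h.2.2.2⟩

theorem swap_left (h : T.IsTriangle i j k) : T.IsTriangle j i k :=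
  ⟨h.1.symm, h.2.2.1, h.2.1, by rw [Finset.insert_comm]; exact h.2.2.2⟩

theorem edgeCos_mem (h : T.IsTriangle i j k) : T.edgeCos i j ∈ Icc (0 : ℝ) 1 := by
  refine T.edgeCos_mem h.1 (T.mem_complex_of_subset h.2.2.2 ?_ (by simp))
  intro v hv
  simp only [Finset.mem_insert, Finset.mem_singleton] at hv ⊢
  tauto

end IsTriangle

theorem edgeLength_sq (T : WeightedTriangulation M V) {r : V → ℝ} (hr : IsCirclePackingMetric r)
    (i j : V) : T.edgeLength r i j ^ 2 = r i ^ 2 + r j ^ 2 + 2 * r i * r j * T.edgeCos i j := by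
  refine Real.sq_sqrt ?_
  have := Real.neg_one_le_cos (T.weight s(i, j))
  nlinarith [sq_nonneg (r i - r j), mul_pos (hr i) (hr j)]

theorem innerAngle_eq (T : WeightedTriangulation M V) {r : V → ℝ} (hr : IsCirclePackingMetric r)
    (i j k : V) : T.innerAngle r i j k =
      Real.arccos (cosAngle (T.edgeCos i j) (T.edgeCos i k) (T.edgeCos j k) (r i) (r j) (r k)) := by
  rw [innerAngle, T.edgeLength_sq hr, T.edgeLength_sq hr, T.edgeLength_sq hr, mul_assoc 2 (T.edgeLength r i j),
    show ∀ a b c x y z : ℝ, x ^ 2 + y ^ 2 + 2 * x * y * a + (x ^ 2 + z ^ 2 + 2 * x * z * b) -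
      (y ^ 2 + z ^ 2 + 2 * y * z * c) =
      2 * (x ^ 2 + a * x * y + b * x * z - c * y * z) by intros; ring,
    mul_div_mul_left _ _ two_ne_zero]
  rfl

theorem edgeLength_smul (T : WeightedTriangulation M V) {t : ℝ} (ht : 0 < t) (r : V → ℝ)
    (i j : V) : T.edgeLength (t • r) i j = t * T.edgeLength r i j := by
  simp only [edgeLength, Pi.smul_apply, smul_eq_mul]
  rw [← Real.sqrt_sq ht.le, ← Real.sqrt_mul (sq_nonneg _), Real.sqrt_sq ht.le]
  congr 1
  ring

theorem innerAngle_smul (T : WeightedTriangulation M V) {t : ℝ} (ht : 0 < t) (r : V → ℝ)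
    (i j k : V) : T.innerAngle (t • r) i j k = T.innerAngle r i j k := by
  simp only [innerAngle, T.edgeLength_smul ht]
  rw [← mul_div_mul_left _ (2 * T.edgeLength r i j * T.edgeLength r i k) (pow_pos ht 2).ne']
  congr 2 <;> ring

theorem classicalCurvature_smul (T : WeightedTriangulation M V) {t : ℝ} (ht : 0 < t) (r : V → ℝ)
    (i : V) : T.classicalCurvature (t • r) i = T.classicalCurvature r i := by
  simp only [classicalCurvature, T.innerAngle_smul ht]

/-! ### The discrete maximum principle -/

theorem innerAngle_le_innerAngle (T : WeightedTriangulation M V) {r s : V → ℝ}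
    (hr : IsCirclePackingMetric r) (hs : IsCirclePackingMetric s) (hrs : r ≤ s) {i j k : V}
    (hi : r i = s i) (h : T.IsTriangle i j k) : T.innerAngle r i j k ≤ T.innerAngle s i j k := by
  rw [T.innerAngle_eq hr, T.innerAngle_eq hs, ← hi]
  exact Real.arccos_le_arccos (cosAngle_le_cosAngle h.edgeCos_mem h.swap_right.edgeCos_mem
    h.swap_left.swap_right.edgeCos_mem.1 (hr i) (hr j) (hr k) (hrs j) (hrs k))

/-- The discrete maximum principle: if one metric lies below another and they agree at a vertex,
then the curvature there of the smaller one is at least that of the larger one. -/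
theorem classicalCurvature_anti (T : WeightedTriangulation M V) {r s : V → ℝ}
    (hr : IsCirclePackingMetric r) (hs : IsCirclePackingMetric s) (hrs : r ≤ s) {i : V}
    (hi : r i = s i) : T.classicalCurvature s i ≤ T.classicalCurvature r i := by
  classical
  unfold classicalCurvature
  gcongr with j _ k _
  split_ifs with h
  · exact T.innerAngle_le_innerAngle hr hs hrs hi h
  · exact le_rfl

/-- Termwise inequalities between equal sums are equalities. -/
theorem innerAngle_eq_of_classicalCurvature_eq (T : WeightedTriangulation M V) {r s : V → ℝ}
    (hr : IsCirclePackingMetric r) (hs : IsCirclePackingMetric s) (hrs : r ≤ s) {i j k : V}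
    (hi : r i = s i) (hK : T.classicalCurvature r i = T.classicalCurvature s i)
    (h : T.IsTriangle i j k) : T.innerAngle r i j k = T.innerAngle s i j k := by
  classical
  have hle : ∀ j k, (if T.IsTriangle i j k then T.innerAngle r i j k else 0) ≤
      if T.IsTriangle i j k then T.innerAngle s i j k else 0 := by
    intro j k
    split_ifs with h
    · exact T.innerAngle_le_innerAngle hr hs hrs hi h
    · exact le_rfl
  have hsum : (∑ j, ∑ k, if T.IsTriangle i j k then T.innerAngle r i j k else 0) =
      ∑ j, ∑ k, if T.IsTriangle i j k then T.innerAngle s i j k else 0 := by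
    unfold classicalCurvature at hK
    linarith
  have h1 := (Finset.sum_eq_sum_iff_of_le fun j _ => Finset.sum_le_sum fun k _ => hle j k).1 hsum
    j (Finset.mem_univ j)
  have h2 := (Finset.sum_eq_sum_iff_of_le fun k _ => hle j k).1 h1 k (Finset.mem_univ k)
  simpa [h] using h2

theorem eq_of_isTriangle_of_ne (T : WeightedTriangulation M V) {r s : V → ℝ}
    (hr : IsCirclePackingMetric r) (hs : IsCirclePackingMetric s) (hrs : r ≤ s) {i j k : V}
    (hi : r i = s i) (hK : T.classicalCurvature r i = T.classicalCurvature s i)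
    (h : T.IsTriangle i j k)
    (hcos : T.edgeCos i j < 1 ∨ 0 < T.edgeCos i k ∨ 0 < T.edgeCos j k) : r j = s j := by
  have hab := h.edgeCos_mem
  have hac := h.swap_right.edgeCos_mem
  have hbc := h.swap_left.swap_right.edgeCos_mem
  have hangle := T.innerAngle_eq_of_classicalCurvature_eq hr hs hrs hi hK h
  rw [T.innerAngle_eq hr, T.innerAngle_eq hs, ← hi] at hangle
  have hcosangle := Real.arccos_injOn
    (abs_le.1 (abs_cosAngle_le_one hab hac hbc (hr i) (hr j) (hr k)))
    (abs_le.1 (abs_cosAngle_le_one hab hac hbc (hr i) (hs j) (hs k))) hangle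
  exact eq_of_cosAngle_le_cosAngle hab hac hbc.1 (hr i) (hr j) (hr k) (hrs j) (hrs k) hcos
    hcosangle.le

/-- The strong discrete maximum principle in a triangle. In the degenerate case, where the circles
at `i` and `j` are tangent and orthogonal to the one at `k`, equality passes from `i` to `j`
through `k`. -/
theorem eq_of_isTriangle (T : WeightedTriangulation M V) {r s : V → ℝ}
    (hr : IsCirclePackingMetric r) (hs : IsCirclePackingMetric s) (hrs : r ≤ s)
    (hK : ∀ i, T.classicalCurvature r i = T.classicalCurvature s i) {i j k : V}
    (hi : r i = s i) (h : T.IsTriangle i j k) : r j = s j := by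
  by_cases hcos : T.edgeCos i j < 1 ∨ 0 < T.edgeCos i k ∨ 0 < T.edgeCos j k
  · exact T.eq_of_isTriangle_of_ne hr hs hrs hi (hK i) h hcos
  · simp only [not_or, not_lt] at hcos
    have hk : r k = s k := T.eq_of_isTriangle_of_ne hr hs hrs hi (hK i) h.swap_right
      (Or.inl (hcos.2.1.trans_lt one_pos))
    exact T.eq_of_isTriangle_of_ne hr hs hrs hk (hK k) h.swap_right.swap_left.swap_right
      (Or.inl (by rw [T.edgeCos_comm]; exact hcos.2.2.trans_lt one_pos))

theorem eq_of_classicalCurvature_eq [ConnectedSpace M] [ChartedSpace (EuclideanSpace ℝ (Fin 2)) M]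
    (T : WeightedTriangulation M V) {r s : V → ℝ}
    (hr : IsCirclePackingMetric r) (hs : IsCirclePackingMetric s) (hrs : r ≤ s)
    (hK : ∀ i, T.classicalCurvature r i = T.classicalCurvature s i) {i : V}
    (hi : r i = s i) : r = s := by
  have hall : {v | r v = s v} = univ := by
    refine T.eq_univ_of_edge_closed ⟨i, hi⟩ fun v hv w hvw hedge => ?_
    obtain ⟨k, hk⟩ := T.exists_isTriangle hvw hedge
    exact T.eq_of_isTriangle hr hs hrs hK hv hk
  exact funext fun v => (eq_univ_iff_forall.1 hall v : _)

theorem nonempty_vertices [Nonempty M] (T : WeightedTriangulation M V) : Nonempty V := by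
  obtain ⟨q⟩ := ‹Nonempty M›
  obtain ⟨⟨-, hsum⟩, -⟩ := (T.homeo.symm q).2
  by_contra h
  rw [not_nonempty_iff] at h
  simp at hsum

end CirclePacking.WeightedTriangulation

/-! ### Comparison of two metrics by scaling -/

namespace CirclePacking

theorem IsCirclePackingMetric.smul {V : Type*} {r : V → ℝ} (hr : IsCirclePackingMetric r) {t : ℝ}
    (ht : 0 < t) : IsCirclePackingMetric (t • r) := fun i => mul_pos ht (hr i)

/-- Two circle packing metrics become comparable, with contact at a vertex, after rescaling. -/
theorem IsCirclePackingMetric.exists_smul_ge {V : Type*} [Finite V] [Nonempty V] {r s : V → ℝ}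
    (hr : IsCirclePackingMetric r) (hs : IsCirclePackingMetric s) :
    ∃ t : ℝ, 0 < t ∧ s ≤ t • r ∧ ∃ i, s i = (t • r) i := by
  obtain ⟨i, hi⟩ := Finite.exists_max fun v => s v / r v
  refine ⟨s i / r i, div_pos (hs i) (hr i), fun v => (div_le_iff₀ (hr v)).1 (hi v), i, ?_⟩
  exact (div_mul_cancel₀ (s i) (hr i).ne').symm

theorem WeightedTriangulation.classicalCurvature_eq {M : Type*} [TopologicalSpace M] {V : Type*}
    [Fintype V] [DecidableEq V] (T : WeightedTriangulation M V) {r : V → ℝ}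
    (hr : IsCirclePackingMetric r) {c : ℝ} {i : V} (h : T.curvature r i = c) :
    T.classicalCurvature r i = c * r i ^ 2 :=
  (div_eq_iff (pow_pos (hr i) 2).ne').1 h

theorem WeightedTriangulation.le_of_curvature_neg {M : Type*} [TopologicalSpace M] {V : Type*}
    [Fintype V] [DecidableEq V] (T : WeightedTriangulation M V) {r s : V → ℝ}
    (hr : IsCirclePackingMetric r) (hs : IsCirclePackingMetric s) {c : ℝ} (hc : c < 0)
    (hrc : ∀ i, T.curvature r i = c) (hsc : ∀ i, T.curvature s i = c) : s ≤ r := by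
  cases isEmpty_or_nonempty V
  · exact fun v => isEmptyElim v
  obtain ⟨t, ht, hle, i, hi⟩ := hr.exists_smul_ge hs
  have hK := T.classicalCurvature_anti hs (hr.smul ht) hle hi
  rw [T.classicalCurvature_smul ht, T.classicalCurvature_eq hr (hrc i),
    T.classicalCurvature_eq hs (hsc i), mul_le_mul_left_of_neg hc,
    pow_le_pow_iff_left₀ (hs i).le (hr i).le two_ne_zero, hi] at hK
  -- At the contact vertex `hK` now reads t r_i ≤ r_i.
  have ht1 : t ≤ 1 := (mul_le_iff_le_one_left (hr i)).1 hK
  exact fun v => (hle v).trans (mul_le_of_le_one_left (hr v).le ht1)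

end CirclePacking

theorem mainTheorem9
    {M : Type*} [TopologicalSpace M] [T2Space M] [CompactSpace M] [ConnectedSpace M]
    [ChartedSpace (EuclideanSpace ℝ (Fin 2)) M]
    {V : Type*} [Fintype V] [DecidableEq V]
    (T : CirclePacking.WeightedTriangulation M V) (c : ℝ) :
    (c < 0 → ∀ r r' : V → ℝ,
      CirclePacking.IsCirclePackingMetric r → CirclePacking.IsCirclePackingMetric r' →
      (∀ i, T.curvature r i = c) → (∀ i, T.curvature r' i = c) → r = r') ∧
    (c = 0 → ∀ r r' : V → ℝ,
      CirclePacking.IsCirclePackingMetric r → CirclePacking.IsCirclePackingMetric r' →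
      (∀ i, T.curvature r i = c) → (∀ i, T.curvature r' i = c) →
      ∃ t : ℝ, 0 < t ∧ ∀ i, r' i = t * r i) := by
  refine ⟨fun hc r r' hr hr' hrc hrc' => ?_, ?_⟩
  · exact le_antisymm (T.le_of_curvature_neg hr' hr hc hrc' hrc)
      (T.le_of_curvature_neg hr hr' hc hrc hrc')
  · rintro rfl r r' hr hr' hrc hrc'
    have := T.nonempty_vertices
    obtain ⟨t, ht, hle, i, hi⟩ := hr.exists_smul_ge hr'
    refine ⟨t, ht, fun v => congrFun (T.eq_of_classicalCurvature_eq hr' (hr.smul ht) hle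
      (fun v => ?_) hi) v⟩
    rw [T.classicalCurvature_smul ht, T.classicalCurvature_eq hr (hrc v),
      T.classicalCurvature_eq hr' (hrc' v), zero_mul, zero_mul]
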